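/- For cardinals $\lambda\ge\mu\ge\sigma+\theta_0+\theta_1$, call a *test family* (for $\lambda,\mu,\theta_0,\theta_1$) a pair of sequences $\bar\zeta^{k}=\langle \zeta^{k}_{\alpha,i}:\alpha<\mu,\ i<\mathbf i_k\rangle$ $(k=0,1)$, with ordinals $\mathbf i_0<\theta_0$ and $\mathbf i_1<\theta_1$, such that each $\bar\zeta^{k}$ is a sequence without repetitions of ordinals $<\lambda$ and $\bar\zeta^{0},\bar\zeta^{1}$ have disjoint ranges. * $\Pr_1(\lambda,\mu,\sigma,(\theta_0,\theta_1))$ means: there is $\mathbf c:[\lambda]^2\to\sigma$ such that for every test family and every $\gamma<\sigma$ there are $\alpha_0<\alpha_1<\mu$ with $\mathbf c\{\zeta^0_{\alpha_0,i_0},\zeta^1_{\alpha_1,i_1}\}=\gamma$ for all $i_0<\mathbf i_0$ and $i_1<\mathbf i_1$. We write $\Pr_1(\lambda,\mu,\sigma,\theta)$ for $\Pr_1(\lambda,\mu,\sigma,(\theta,\theta))$. * $\Pr_{0,0}(\lambda,\mu,\sigma,(\theta_0,\theta_1))$ means: there is $\mathbf c:[\lambda]^2\to\sigma$ such that for every test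 family and every $h:\mathbf i_0\to\sigma$ there are $\alpha_0<\alpha_1<\mu$ with $\mathbf c\{\zeta^0_{\alpha_0,i_0},\zeta^1_{\alpha_1,i_1}\}=h(i_0)$ for all $i_0<\mathbf i_0$ and $i_1<\mathbf i_1$. **Theorem.** Let $\kappa$ be a regular (infinite) cardinal, and let $\kappa^{+4}$ be its fourth cardinal successor. Then 1. $\Pr_1(\kappa^{+4},\kappa^{+4},\kappa^{+4},\kappa^+)$ holds; 2. $\Pr_1(\kappa^{+4},\kappa^{+4},\kappa^{+4},(\kappa,\kappa^+))$ and $\Pr_{0,0}(\kappa^{+4},\kappa^{+4},\kappa^{+4},(\aleph_0,\kappa^+))$ hold. -/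

import Mathlib

open Cardinal Ordinal

universe u

/-- The data that a colouring is tested against.  Ordinals below a cardinal `c` are the elements
of `Set.Iio c.ord`, and the pair of bounds `(θ₀, θ₁)` is a function on `Fin 2`.
For `k = 0, 1`, `ζ k = ⟨ζᵏ_{α,j} : α < μ, j < i k⟩` is a sequence without repetitions of ordinals
below `lam`, with `i k < θ k`, and the ranges of `ζ 0` and `ζ 1` are disjoint. -/
def IsTestFamily (lam μ : Cardinal.{u}) (θ : Fin 2 → Cardinal.{u}) (i : Fin 2 → Ordinal.{u})
    (ζ : (k : Fin 2) → Set.Iio μ.ord × Set.Iio (i k) → Set.Iio lam.ord) : Prop :=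
  (∀ k, i k < (θ k).ord) ∧ (∀ k, Function.Injective (ζ k)) ∧
    Disjoint (Set.range (ζ 0)) (Set.range (ζ 1))

/-- `Pr₁(lam, μ, σ, (θ 0, θ 1))`, used when `lam ≥ μ ≥ σ + θ 0 + θ 1`.
The colouring of the pairs of ordinals below `lam` is a function on `Sym2`; its values on the
diagonal play no role, as the two ranges of a test family are disjoint. -/
def Pr₁ (lam μ σ : Cardinal.{u}) (θ : Fin 2 → Cardinal.{u}) : Prop :=
  ∃ c : Sym2 (Set.Iio lam.ord) → Set.Iio σ.ord,
    ∀ (i : Fin 2 → Ordinal.{u})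
      (ζ : (k : Fin 2) → Set.Iio μ.ord × Set.Iio (i k) → Set.Iio lam.ord),
      IsTestFamily lam μ θ i ζ →
      ∀ γ : Set.Iio σ.ord,
        ∃ α₀ α₁ : Set.Iio μ.ord, α₀ < α₁ ∧
          ∀ (j₀ : Set.Iio (i 0)) (j₁ : Set.Iio (i 1)), c s(ζ 0 (α₀, j₀), ζ 1 (α₁, j₁)) = γ

/-- `Pr_{0,0}(lam, μ, σ, (θ 0, θ 1))`, used when `lam ≥ μ ≥ σ + θ 0 + θ 1`: the prescribed colour
is a function of the first index only. -/
def Pr₀₀ (lam μ σ : Cardinal.{u}) (θ : Fin 2 → Cardinal.{u}) : Prop :=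
  ∃ c : Sym2 (Set.Iio lam.ord) → Set.Iio σ.ord,
    ∀ (i : Fin 2 → Ordinal.{u})
      (ζ : (k : Fin 2) → Set.Iio μ.ord × Set.Iio (i k) → Set.Iio lam.ord),
      IsTestFamily lam μ θ i ζ →
      ∀ h : Set.Iio (i 0) → Set.Iio σ.ord,
        ∃ α₀ α₁ : Set.Iio μ.ord, α₀ < α₁ ∧
          ∀ (j₀ : Set.Iio (i 0)) (j₁ : Set.Iio (i 1)), c s(ζ 0 (α₀, j₀), ζ 1 (α₁, j₁)) = h j₀

/-!
Write `Θ`, `T`, `X`, `Λ` for well orders of type `κ⁺`, `κ⁺⁺`, `κ⁺³`, `κ⁺⁴`.  All three claims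
follow from one colouring of pairs from `Λ` (`exists_strong_colouring`), which takes each value
constantly on some product `a α₀ × b α₁` for any two sequences of disjoint sets of size less than
`#Θ`.

The colouring is defined from walks `ξ = β₀ > β₁ > ⋯ > ζ` along a ladder system `C β ⊆ β` of
ladders of type at most `#X`.  A point `δ` of cofinality `#X` is not a limit of any ladder `C β`
with `β > δ`, so the walks from fewer than `#X` points above `δ` to all points close below `δ`
pass through `δ` (`IsStepFunction.exists_walk_append`).  The next step from `δ` leads to the least
element of `C δ` above `ζ`, and it is the same for all `ζ ∈ a α₀` if `a α₀` lies in one interval of `C δ`.  So it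
suffices to recognize this step on each walk: the colour is then `g δ`, where `g` has stationary
fibres.

For this, steps get levels in `T`.  By an Ulam matrix argument that takes the place of club
guessing (`IsStepFunction.exists_levels`), for suitable `δ` of each colour there are steps from
`δ`, valid for long intervals close to `δ`, of arbitrarily high level; hence also, for each `i :
T`, sets `b α` above `δ` all of whose walks to `δ` reach level `i` (`exists_forall_level_ge`).
Now let `ψ q` inject the levels below `q` into `Θ`, and look at the records (new maximal levels)
along a walk.  Choose `#Θ` many `i` for which the values `ψ q p`, for `p`, `q` on walks from `b (α
i)` to `δ`, have a common bound, then a step from `δ` of a level `j` above all those walks, and a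
set `a α₀` in its interval.  Since `ψ j` is injective, some `i` makes all `ψ j p`, for `p ≥ i` a
level on these walks, exceed both that bound and the values of `ψ` on the walks from `δ` to `a
α₀`.  Then the step from `δ` is recognized as the record where `ψ` of the new record and the
previous one is largest (`recordColour_append`).

For `Pr₀₀`, `Λ` embeds into the power set of `X`, so finitely many points of `Λ` are distinguished
by their traces on a finite subset of `X`.  There are only `#X` patterns of traces, so one pattern
occurs `#Λ` many times, and a single colour can code which value is prescribed for which trace
(`IsStrongColouring.exists_rows`).
-/

open Set

/-! ### Regular well orders -/

/-- A well order whose order type is a regular cardinal, expressed by cardinalities: the number of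
elements is regular, and it is larger than the number of elements below any given one. -/
structure IsRegularOrder (A : Type u) [LinearOrder A] : Prop where
  isRegular : (#A).IsRegular
  card_Iio_lt (x : A) : #(Iio x) < #A

namespace IsRegularOrder

variable {A B I : Type u} [LinearOrder A]

theorem card_Iic_lt (hA : IsRegularOrder A) (x : A) : #(Iic x) < #A := by
  rw [← Iio_insert]
  exact (mk_insert_le).trans_lt
    (add_lt_of_lt hA.isRegular.aleph0_le (hA.card_Iio_lt x)
      ((hA.isRegular.nat_lt 1).trans_le' (by simp)))

theorem exists_forall_lt (hA : IsRegularOrder A) (f : I → A) (hI : #I < #A) :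
    ∃ y, ∀ i, f i < y := by
  by_contra! h
  have h1 : (⋃ i, Iic (f i)) = Set.univ := by
    refine eq_univ_of_forall fun y => ?_
    obtain ⟨i, hi⟩ := h y
    exact mem_iUnion.2 ⟨i, hi⟩
  have h2 : #(⋃ i, Iic (f i)) < #A :=
    (card_iUnion_lt_iff_forall_of_isRegular hA.isRegular hI).2 fun i => hA.card_Iic_lt _
  rw [h1, mk_univ] at h2
  exact lt_irrefl _ h2

theorem exists_forall_mem_lt (hA : IsRegularOrder A) (s : Set A) (hs : #s < #A) :
    ∃ y, ∀ x ∈ s, x < y := by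
  obtain ⟨y, hy⟩ := hA.exists_forall_lt (fun x : s => (x : A)) hs
  exact ⟨y, fun x hx => hy ⟨x, hx⟩⟩

theorem exists_forall_mem_lt_of_finite (hA : IsRegularOrder A) {s : Set A} (hs : s.Finite) :
    ∃ y, ∀ x ∈ s, x < y :=
  hA.exists_forall_mem_lt s ((lt_aleph0_iff_set_finite.2 hs).trans_le hA.isRegular.aleph0_le)

theorem exists_lt (hA : IsRegularOrder A) (x : A) : ∃ y, x < y := by
  obtain ⟨y, hy⟩ := hA.exists_forall_mem_lt_of_finite (finite_singleton x)
  exact ⟨y, hy x rfl⟩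

theorem exists_lt_lt (hA : IsRegularOrder A) (x y : A) : ∃ z, x < z ∧ y < z := by
  obtain ⟨z, hz⟩ := hA.exists_lt (max x y)
  exact ⟨z, (le_max_left _ _).trans_lt hz, (le_max_right _ _).trans_lt hz⟩

theorem nonempty (hA : IsRegularOrder A) : Nonempty A :=
  mk_ne_zero_iff.1 hA.isRegular.pos.ne'

/-- Every fibre of a function on a regular well order can be taken as large as the whole order. -/
theorem exists_card_fiber (hA : IsRegularOrder A) (f : A → B) (hB : #B < #A) :
    ∃ b, #(f ⁻¹' {b}) = #A :=
  infinite_pigeonhole f hA.isRegular.aleph0_le (by rwa [hA.isRegular.cof_ord])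

theorem exists_mem_gt (hA : IsRegularOrder A) {s : Set A} (hs : #s = #A) (x : A) :
    ∃ y ∈ s, x < y := by
  by_contra! h
  exact ((mk_le_mk_of_subset fun y hy => h y hy).trans_lt (hA.card_Iic_lt x)).ne hs

/-- If the next element can always be chosen in relation `R` to the fewer than `#A` elements
chosen before, then there is a sequence indexed by `I` with any two terms in relation `R`. -/
theorem exists_seq {J : Type*} {I : Type*} [LinearOrder I] [WellFoundedLT I] (P : J → Prop)
    (R : J → J → Prop) (h : ∀ (x : I) (f : Iio x → J), ∃ y, P y ∧ ∀ i, R (f i) y) :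
    ∃ o : I → J, (∀ x, P (o x)) ∧ ∀ x y, x < y → R (o x) (o y) := by
  choose F hP hR using h
  let o : I → J := (wellFounded_lt (α := I)).fix fun x f => F x fun i => f i.1 i.2
  have ho : ∀ x, o x = F x fun i => o i.1 := fun x => WellFounded.fix_eq _ _ _
  refine ⟨o, fun x => ?_, fun x y hxy => ?_⟩
  · rw [ho]; exact hP _ _
  · rw [ho y]; exact hR y (fun i => o i.1) ⟨x, hxy⟩

/-- Over an order of size `#B⁺` there is a uniform choice of injections of initial segments into
`B`. -/
theorem exists_injOn (hA : IsRegularOrder A) (hAB : #A = Order.succ #B) :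
    ∃ e : A → A → B, ∀ x, InjOn (e x) (Iio x) := by
  have hB : Nonempty B := by
    by_contra hB
    rw [not_nonempty_iff] at hB
    have := hA.isRegular.nat_lt 1
    rw [hAB, mk_eq_zero, Order.lt_succ_iff] at this
    simp at this
  have : ∀ x : A, ∃ e : A → B, InjOn e (Iio x) := fun x => by
    have h := hA.card_Iio_lt x
    rw [hAB, Order.lt_succ_iff] at h
    obtain ⟨e⟩ := h
    classical
    refine ⟨fun y => if hy : y < x then e ⟨y, hy⟩ else Classical.arbitrary B, ?_⟩
    intro y hy z hz hyz
    rw [mem_Iio] at hy hz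
    simp only [hy, hz, dif_pos] at hyz
    exact congrArg Subtype.val (e.injective hyz)
  exact ⟨fun x => (this x).choose, fun x => (this x).choose_spec⟩

end IsRegularOrder

theorem isRegularOrder_ord_toType {c : Cardinal.{u}} (hc : c.IsRegular) :
    IsRegularOrder c.ord.ToType where
  isRegular := by rwa [mk_ord_toType]
  card_Iio_lt x := by rw [mk_ord_toType]; simpa using mk_Iio_lt x (by simp)

/-! ### Stationary sets of points of large cofinality -/

section

variable {Λ X : Type u} [LinearOrder Λ]

/-- Fewer than `c` points below `δ` are always bounded strictly below `δ`; that is, `δ` is a limit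
point of cofinality at least `c` when `c` is infinite. -/
def CofinalityGE (c : Cardinal.{u}) (δ : Λ) : Prop :=
  ∀ s : Set Λ, (∀ x ∈ s, x < δ) → #s < c → ∃ y < δ, ∀ x ∈ s, x < y

/-- The point `δ` is closed under `f`.  In a regular order the sets of closure points of functions
generate the club filter, so that these functions replace clubs throughout. -/
def ClosedUnder (f : Λ → Λ) (δ : Λ) : Prop :=
  ∀ x < δ, f x < δ

/-- A stationary set of points, with functions in the place of clubs. -/
def StationaryPred (p : Λ → Prop) : Prop :=
  ∀ f : Λ → Λ, ∃ δ, p δ ∧ ClosedUnder f δ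

theorem CofinalityGE.exists_forall_lt {c : Cardinal.{u}} {δ : Λ} (hδ : CofinalityGE c δ)
    {I : Type u} (f : I → Λ) (hf : ∀ i, f i < δ) (hI : #I < c) : ∃ y < δ, ∀ i, f i < y := by
  obtain ⟨y, hy, h⟩ := hδ (range f) (by rintro _ ⟨i, rfl⟩; exact hf i) (mk_range_le.trans_lt hI)
  exact ⟨y, hy, fun i => h _ ⟨i, rfl⟩⟩

theorem CofinalityGE.exists_lt {c : Cardinal.{u}} {δ : Λ} (hδ : CofinalityGE c δ) (hc : 0 < c) :
    ∃ y, y < δ := by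
  obtain ⟨y, hy, -⟩ := hδ ∅ (by simp) (by simpa using hc)
  exact ⟨y, hy⟩

/-- The points of cofinality at least `#X` are stationary in a larger regular order. -/
theorem stationaryPred_cofinalityGE [WellFoundedLT Λ] [LinearOrder X] [WellFoundedLT X]
    (hΛ : IsRegularOrder Λ) (hX : IsRegularOrder X) (hlt : #X < #Λ) :
    StationaryPred (CofinalityGE (Λ := Λ) #X) := by
  intro f
  obtain ⟨o, -, ho⟩ := IsRegularOrder.exists_seq (I := X) (J := Λ) (fun _ => True)
    (fun x y => x < y ∧ ∀ z ≤ x, f z < y) (fun ν g => by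
      have h1 : ∀ i : Iio ν, ∃ y, g i < y ∧ ∀ z ≤ g i, f z < y := fun i => by
        obtain ⟨y, hy⟩ := hΛ.exists_forall_lt (fun z : Iic (g i) => f z) (hΛ.card_Iic_lt _)
        obtain ⟨y', h, h'⟩ := hΛ.exists_lt_lt (g i) y
        exact ⟨y', h, fun z hz => (hy ⟨z, hz⟩).trans h'⟩
      choose y hy hy' using h1
      obtain ⟨b, hb⟩ := hΛ.exists_forall_lt y ((hX.card_Iio_lt ν).trans hlt)
      exact ⟨b, trivial, fun i => ⟨(hy i).trans (hb i), fun z hz => (hy' i z hz).trans (hb i)⟩⟩)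
  have hne : {y | ∀ ν, o ν < y}.Nonempty := hΛ.exists_forall_lt o hlt
  let δ := (wellFounded_lt (α := Λ)).min _ hne
  have hδ : ∀ ν, o ν < δ := WellFounded.min_mem _ _ hne
  have hmin : ∀ x < δ, ∃ ν, x ≤ o ν := fun x hx => by
    by_contra! h
    exact WellFounded.not_lt_min (wellFounded_lt (α := Λ)) (s := {y | ∀ ν, o ν < y}) h hx
  refine ⟨δ, fun s hs hcard => ?_, fun x hx => ?_⟩
  · choose ν hν using fun x : s => hmin x (hs x x.2)
    obtain ⟨ν', hν'⟩ := hX.exists_forall_lt ν hcard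
    exact ⟨o ν', hδ _, fun x hx => (hν ⟨x, hx⟩).trans_lt (ho _ _ (hν' ⟨x, hx⟩)).1⟩
  · obtain ⟨ν, hν⟩ := hmin x hx
    obtain ⟨ν', hν'⟩ := hX.exists_lt ν
    exact ((ho _ _ hν').2 x hν).trans (hδ _)

theorem IsRegularOrder.exists_forall_apply_lt {I : Type u} (hΛ : IsRegularOrder Λ)
    (hI : #I < #Λ) (f : I → Λ → Λ) : ∃ F : Λ → Λ, ∀ i x, f i x < F x := by
  choose F hF using fun x => hΛ.exists_forall_lt (fun i => f i x) hI
  exact ⟨F, fun i x => hF x i⟩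

/-- A stationary set of points of large cofinality splits into `#Λ` stationary sets, the fibres of
`g` (an Ulam matrix argument). -/
theorem exists_stationaryPred_fibers (hΛ : IsRegularOrder Λ)
    (hcard : #Λ = Order.succ #X) {p : Λ → Prop} (hne : ∀ δ, p δ → ∃ y, y < δ)
    (hp : StationaryPred p) : ∃ g : Λ → Λ, ∀ c, StationaryPred fun δ => p δ ∧ g δ = c := by
  have hlt : #X < #Λ := by rw [hcard]; exact Order.lt_succ _
  obtain ⟨e, he⟩ := hΛ.exists_injOn hcard
  have h1 : ∀ α, ∃ τ : X, StationaryPred fun δ => p δ ∧ α < δ ∧ e δ α = τ := by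
    intro α
    by_contra! h
    simp only [StationaryPred] at h
    push Not at h
    choose f hf using h
    obtain ⟨F, hF⟩ := hΛ.exists_forall_apply_lt hlt f
    obtain ⟨δ, hpδ, hδ⟩ := hp fun x => max (F x) α
    obtain ⟨y, hy⟩ := hne δ hpδ
    exact hf (e δ α) δ ⟨hpδ, (le_max_right _ _).trans_lt (hδ y hy), rfl⟩
      fun x hx => (hF _ x).trans ((le_max_left _ _).trans_lt (hδ x hx))
  choose τ hτ using h1
  obtain ⟨t, ht⟩ := hΛ.exists_card_fiber τ hlt
  obtain ⟨π⟩ := Cardinal.eq.1 ht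
  classical
  let g : Λ → Λ := fun δ =>
    if h : ∃ α : τ ⁻¹' {t}, α < δ ∧ e δ α = t then π h.choose else δ
  refine ⟨g, fun c f => ?_⟩
  obtain ⟨δ, ⟨hpδ, hlt', heq⟩, hcl⟩ := hτ (π.symm c) f
  refine ⟨δ, ⟨hpδ, ?_⟩, hcl⟩
  have heq' : e δ (π.symm c) = t := heq.trans (π.symm c).2
  have h : ∃ α : τ ⁻¹' {t}, α < δ ∧ e δ α = t := ⟨π.symm c, hlt', heq'⟩
  have h2 : h.choose = π.symm c :=
    Subtype.ext (he δ h.choose_spec.1 hlt' (h.choose_spec.2.trans heq'.symm))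
  simp only [g, dif_pos h, h2, Equiv.apply_symm_apply]

end

/-! ### Step functions and walks -/

section

variable {Λ X : Type u} [LinearOrder Λ] [LinearOrder X]

/-- The step function of a ladder system: `st β α` is the least element `≥ α` of a cofinal subset
`C β` of `β`, and `r β` is strictly increasing on `C β`.  Only these consequences are recorded:
the values of `st β` below `β` are the right ends of the intervals on which `st β` is constant, and
`r β` is strictly increasing on these values. -/
structure IsStepFunction (st : Λ → Λ → Λ) (r : Λ → Λ → X) : Prop where
  le {α β : Λ} : α < β → α ≤ st β α
  lt {α β : Λ} : α < β → st β α < β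
  eq_of_le {α α' β : Λ} : α ≤ α' → α' < β → α' ≤ st β α → st β α' = st β α
  rank_lt {α α' β : Λ} : α < β → α' < β → st β α < st β α' → r β (st β α) < r β (st β α')

/-- Given an injection `e β : Iio β → X`, let `C β` consist of the `γ < β` such that all elements of
`Iio β` with a smaller `e β`-value than `γ` are themselves smaller than `γ`. -/
theorem exists_isStepFunction [WellFoundedLT Λ] [WellFoundedLT X] (hΛ : IsRegularOrder Λ)
    (hcard : #Λ = Order.succ #X) :
    ∃ (st : Λ → Λ → Λ) (r : Λ → Λ → X), IsStepFunction st r := by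
  obtain ⟨e, he⟩ := hΛ.exists_injOn hcard
  let C : Λ → Set Λ := fun β => {γ | γ < β ∧ ∀ γ' < β, e β γ' < e β γ → γ' < γ}
  have hmono : ∀ β, ∀ γ ∈ C β, ∀ γ' ∈ C β, γ < γ' → e β γ < e β γ' := by
    intro β γ hγ γ' hγ' hlt
    by_contra! h
    rcases h.lt_or_eq with h | h
    · exact lt_asymm hlt (hγ.2 γ' hγ'.1 h)
    · exact hlt.ne (he β hγ.1 hγ'.1 h.symm)
  have hne : ∀ β α, α < β → (C β ∩ Ici α).Nonempty := by
    intro β α hα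
    have h1 : (e β '' (Ico α β)).Nonempty := ⟨_, α, ⟨le_rfl, hα⟩, rfl⟩
    obtain ⟨γ, hγ, heq⟩ := WellFounded.min_mem (wellFounded_lt (α := X)) _ h1
    refine ⟨γ, ⟨hγ.2, fun γ' hγ' hlt => ?_⟩, hγ.1⟩
    by_contra! h
    rw [heq] at hlt
    exact WellFounded.not_lt_min (wellFounded_lt (α := X)) (s := e β '' (Ico α β))
      ⟨γ', ⟨hγ.1.trans h, hγ'⟩, rfl⟩ hlt
  classical
  let st : Λ → Λ → Λ := fun β α =>
    if h : (C β ∩ Ici α).Nonempty then (wellFounded_lt (α := Λ)).min _ h else α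
  have hst : ∀ {α β : Λ}, α < β → st β α ∈ C β ∩ Ici α := fun {α β} h => by
    simp only [st, dif_pos (hne β α h)]
    exact WellFounded.min_mem _ _ _
  have hmin : ∀ {α β γ : Λ}, α < β → γ ∈ C β → α ≤ γ → st β α ≤ γ := fun {α β γ} h hγ hle => by
    simp only [st, dif_pos (hne β α h)]
    exact not_lt.1 (WellFounded.not_lt_min (wellFounded_lt (α := Λ))
      (s := C β ∩ Ici α) ⟨hγ, hle⟩)
  refine ⟨st, e, fun h => (hst h).2, fun h => (hst h).1.1, fun {α α' β} h h' h'' => ?_,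
    fun h h' hlt => hmono _ _ (hst h).1 _ (hst h').1 hlt⟩
  exact le_antisymm (hmin h' (hst (h.trans_lt h')).1 h'')
    (hmin (h.trans_lt h') (hst h').1 (h.trans (hst h').2))

namespace IsStepFunction

variable {st : Λ → Λ → Λ} {r : Λ → Λ → X}

theorem eq_of_mem_Icc (h : IsStepFunction st r) {α ζ α' β : Λ} (hα : α ≤ ζ) (hα' : ζ ≤ α')
    (hβ : α' < β) (heq : st β α = st β α') : st β ζ = st β α :=
  h.eq_of_le hα (hα'.trans_lt hβ) (hα'.trans ((h.le hβ).trans heq.ge))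

theorem mono (h : IsStepFunction st r) {α α' β : Λ} (hα : α ≤ α') (hβ : α' < β) :
    st β α ≤ st β α' := by
  by_contra! hlt
  exact hlt.ne (h.eq_of_le hα hβ ((h.le hβ).trans hlt.le))

/-- Few steps from `β` have rank at most a given one. -/
theorem card_steps_lt (h : IsStepFunction st r) (hX : IsRegularOrder X) (β : Λ) (ν : X) :
    #{γ | ∃ α < β, γ = st β α ∧ r β γ ≤ ν} < #X := by
  refine (mk_le_of_injective (β := Iic ν) (f := fun γ => ⟨r β γ.1, γ.2.choose_spec.2.2⟩)
    ?_).trans_lt (hX.card_Iic_lt ν)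
  rintro ⟨γ, α, hα, rfl, hν⟩ ⟨γ', α', hα', rfl, hν'⟩ heq
  have heq := congrArg Subtype.val heq
  simp only [Subtype.mk.injEq] at heq ⊢
  rcases lt_trichotomy (st β α) (st β α') with hlt | heq' | hlt
  · exact absurd heq (h.rank_lt hα hα' hlt).ne
  · exact heq'
  · exact absurd heq (h.rank_lt hα' hα hlt).ne'

/-- A point `δ` of cofinality at least `#X` is not a limit of steps from any `ξ > δ`, so that from
`ξ` the steps towards points just below `δ` and towards `δ` agree. -/
theorem exists_forall_st_eq (h : IsStepFunction st r) (hX : IsRegularOrder X) {δ ξ : Λ}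
    (hδ : CofinalityGE #X δ) (hξ : δ < ξ) : ∃ η < δ, ∀ ζ, η ≤ ζ → ζ < δ → st ξ ζ = st ξ δ := by
  obtain ⟨η, hη, hb⟩ := hδ ({γ | ∃ α < ξ, γ = st ξ α ∧ r ξ γ ≤ r ξ (st ξ δ)} ∩ Iio δ)
    (fun x hx => hx.2) ((mk_le_mk_of_subset inter_subset_left).trans_lt (h.card_steps_lt hX _ _))
  refine ⟨η, hη, fun ζ hζ hζδ => ?_⟩
  have h1 : δ ≤ st ξ ζ := by
    by_contra! hlt
    refine absurd (hb (st ξ ζ) ⟨⟨ζ, hζδ.trans hξ, rfl, ?_⟩, hlt⟩)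
      (hζ.trans (h.le (hζδ.trans hξ))).not_gt
    exact (h.rank_lt (hζδ.trans hξ) hξ (hlt.trans_le (h.le hξ))).le
  exact (h.eq_of_le hζδ.le hξ h1).symm

end IsStepFunction

open Classical in
/-- The steps, as pairs (start, end), of the walk from `ξ` down to `ζ` along `st`.  The condition
that the step goes down is automatic for step functions. -/
noncomputable def walk [WellFoundedLT Λ] (st : Λ → Λ → Λ) (ζ ξ : Λ) : List (Λ × Λ) :=
  if _h : ζ < ξ ∧ st ξ ζ < ξ then (ξ, st ξ ζ) :: walk st ζ (st ξ ζ) else []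
termination_by wellFounded_lt.wrap ξ
decreasing_by exact _h.2

variable [WellFoundedLT Λ] {st : Λ → Λ → Λ} {r : Λ → Λ → X}

theorem walk_self (st : Λ → Λ → Λ) (ζ : Λ) : walk st ζ ζ = [] := by
  rw [walk, dif_neg (fun h => lt_irrefl _ h.1)]

theorem IsStepFunction.walk_of_lt (h : IsStepFunction st r) {ζ ξ : Λ} (hlt : ζ < ξ) :
    walk st ζ ξ = (ξ, st ξ ζ) :: walk st ζ (st ξ ζ) := by
  rw [walk, dif_pos ⟨hlt, h.lt hlt⟩]

/-- Walks from `ξ` towards points just below a point `δ` of large cofinality pass through `δ`. -/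
theorem IsStepFunction.exists_walk_append (h : IsStepFunction st r) (hX : IsRegularOrder X) {δ : Λ}
    (hδ : CofinalityGE #X δ) (ξ : Λ) (hξ : δ ≤ ξ) :
    ∃ η < δ, ∀ ζ, η ≤ ζ → ζ < δ → walk st ζ ξ = walk st δ ξ ++ walk st ζ δ := by
  induction ξ using WellFoundedLT.induction with
  | ind ξ ih =>
    rcases hξ.eq_or_lt with rfl | hlt
    · obtain ⟨η, hη⟩ := hδ.exists_lt hX.isRegular.pos
      exact ⟨η, hη, fun ζ _ _ => by rw [walk_self, List.nil_append]⟩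
    · obtain ⟨η₁, hη₁, h₁⟩ := h.exists_forall_st_eq hX hδ hlt
      obtain ⟨η₂, hη₂, h₂⟩ := ih (st ξ δ) (h.lt hlt) (h.le hlt)
      refine ⟨max η₁ η₂, max_lt hη₁ hη₂, fun ζ hζ hζδ => ?_⟩
      rw [h.walk_of_lt (hζδ.trans hlt), h.walk_of_lt hlt, h₁ ζ ((le_max_left _ _).trans hζ) hζδ,
        h₂ ζ ((le_max_right _ _).trans hζ) hζδ, List.cons_append]

/-- The previous statement simultaneously for fewer than `#X` starting points. -/
theorem IsStepFunction.exists_walk_append_forall (h : IsStepFunction st r) (hX : IsRegularOrder X)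
    {δ : Λ} (hδ : CofinalityGE #X δ) (b : Set Λ) (hb : ∀ ξ ∈ b, δ ≤ ξ) (hcard : #b < #X) :
    ∃ η < δ, ∀ ξ ∈ b, ∀ ζ, η ≤ ζ → ζ < δ → walk st ζ ξ = walk st δ ξ ++ walk st ζ δ := by
  choose η hη hw using fun ξ : b => h.exists_walk_append hX hδ ξ (hb ξ ξ.2)
  obtain ⟨y, hy, hlt⟩ := hδ.exists_forall_lt η hη hcard
  exact ⟨y, hy, fun ξ hξ ζ hζ => hw ⟨ξ, hξ⟩ ζ ((hlt ⟨ξ, hξ⟩).le.trans hζ)⟩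

end

/-! ### Levels of steps -/

section

variable {Λ X T : Type u} [LinearOrder Λ] [LinearOrder X] [LinearOrder T]
  [WellFoundedLT X] {st : Λ → Λ → Λ} {r : Λ → Λ → X}

/-- The intervals on which `st δ` is constant cannot all be short: an orbit of `f` of length `#X`
below `δ` does not fit into fewer than `#X` intervals with at most one point each. -/
theorem IsStepFunction.exists_long_interval (h : IsStepFunction st r) (hΛ : IsRegularOrder Λ)
    (hX : IsRegularOrder X) (hlt : #X < #Λ) (f : Λ → Λ) : ∃ F : Λ → Λ, ∀ δ, ClosedUnder F δ →
      ∀ η < δ, ∃ x y, η ≤ x ∧ x < y ∧ f x < y ∧ y < δ ∧ st δ x = st δ y := by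
  have hseq : ∀ η : Λ, ∃ o : X → Λ, (∀ ν, η ≤ o ν) ∧ ∀ μ ν, μ < ν → o μ < o ν ∧ f (o μ) < o ν := by
    intro η
    refine IsRegularOrder.exists_seq (fun y => η ≤ y) (fun x y => x < y ∧ f x < y) fun ν p => ?_
    obtain ⟨y, hy⟩ := hΛ.exists_forall_lt (fun i => max (max (p i) (f (p i))) η)
      ((hX.card_Iio_lt ν).trans hlt)
    obtain ⟨y', hy', hηy'⟩ := hΛ.exists_lt_lt y η
    refine ⟨y', hηy'.le, fun i => ⟨?_, ?_⟩⟩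
    · exact ((le_max_left _ _).trans (le_max_left _ _)).trans_lt ((hy i).trans hy')
    · exact ((le_max_right _ _).trans (le_max_left _ _)).trans_lt ((hy i).trans hy')
  choose o hηo ho using hseq
  choose F hF using fun η => hΛ.exists_forall_lt (o η) hlt
  refine ⟨F, fun δ hδ η hη => ?_⟩
  by_contra! hcon
  have hlt' : ∀ ν, o η ν < δ := fun ν => (hF η ν).trans (hδ η hη)
  have hne : ∀ μ ν, μ < ν → st δ (o η μ) ≠ st δ (o η ν) := fun μ ν hμν =>
    hcon _ _ (hηo η μ) (ho η μ ν hμν).1 (ho η μ ν hμν).2 (hlt' ν)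
  refine (h.card_steps_lt hX δ (r δ (st δ (F η)))).not_ge
    (mk_le_of_injective (f := fun ν => ⟨st δ (o η ν), o η ν, hlt' ν, rfl, ?_⟩) ?_)
  · rcases (h.mono (hF η ν).le (hδ η hη)).eq_or_lt with heq | hl
    · rw [heq]
    · exact (h.rank_lt (hlt' ν) (hδ η hη) hl).le
  · intro μ ν heq
    have heq := congrArg Subtype.val heq
    rcases lt_trichotomy μ ν with hl | hl | hl
    · exact absurd heq (hne _ _ hl)
    · exact hl
    · exact absurd heq.symm (hne _ _ hl)

/-- Steps can be given levels in `T` and their starting points colours such that for each colour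
and each `f` there is a closure point `δ` of `f` of this colour and of large cofinality, below
which long intervals of `st δ` occur arbitrarily high and with arbitrarily high levels.

The level of a step of rank `ν : X` is the value at `k : X` of an injection `Iio ν → T`, with `k`
depending on the colour only.  Some `k` works: otherwise `#T` many `k` would fail at a common `δ`
with the same bound `t`, and then `#T` many elements would inject into `Iio t`. -/
theorem IsStepFunction.exists_levels [WellFoundedLT Λ] (h : IsStepFunction st r)
    (hΛ : IsRegularOrder Λ) (hX : IsRegularOrder X) (hT : IsRegularOrder T)
    (hΛX : #Λ = Order.succ #X) (hXT : #X = Order.succ #T) :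
    ∃ (g : Λ → Λ) (L : Λ × Λ → T), ∀ (c : Λ) (f : Λ → Λ),
      ∃ δ, CofinalityGE #X δ ∧ ClosedUnder f δ ∧ g δ = c ∧ ∀ η < δ, ∀ t, ∃ x y,
        η ≤ x ∧ x < y ∧ f x < y ∧ y < δ ∧ st δ x = st δ y ∧ t ≤ L (δ, st δ x) := by
  have hltΛ : #X < #Λ := by rw [hΛX]; exact Order.lt_succ _
  have hltX : #T < #X := by rw [hXT]; exact Order.lt_succ _
  obtain ⟨g, hg⟩ := exists_stationaryPred_fibers hΛ hΛX
    (fun δ hδ => CofinalityGE.exists_lt hδ hX.isRegular.pos)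
    (stationaryPred_cofinalityGE hΛ hX hltΛ)
  obtain ⟨e, he⟩ := hX.exists_injOn hXT
  have key : ∀ c, ∃ k : X, ∀ f : Λ → Λ, ∃ δ, CofinalityGE #X δ ∧ ClosedUnder f δ ∧ g δ = c ∧
      ∀ η < δ, ∀ t, ∃ x y, η ≤ x ∧ x < y ∧ f x < y ∧ y < δ ∧ st δ x = st δ y ∧
        t ≤ e (r δ (st δ x)) k := by
    intro c
    by_contra! hcon
    choose f hf using hcon
    obtain ⟨f', hf'⟩ := hΛ.exists_forall_apply_lt hltΛ f
    obtain ⟨F, hF⟩ := h.exists_long_interval hΛ hX hltΛ f'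
    obtain ⟨δ, ⟨hδ, hgδ⟩, hcl⟩ := hg c fun x => max (f' x) (F x)
    choose η hη t ht using fun k => hf k δ hδ
      (fun x hx => (hf' k x).trans ((le_max_left _ _).trans_lt (hcl x hx))) hgδ
    obtain ⟨t₀, ht₀⟩ := hX.exists_card_fiber t hltX
    obtain ⟨K, hK, hKcard⟩ := le_mk_iff_exists_subset.1 (hltX.le.trans ht₀.ge)
    obtain ⟨η₁, hη₁, hη₁'⟩ := hδ.exists_forall_lt (fun k : K => η k) (fun k => hη k)
      (by rwa [hKcard])
    obtain ⟨ν, hν⟩ := hX.exists_forall_mem_lt K (by rwa [hKcard])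
    obtain ⟨η₂, hη₂, hη₂'⟩ := hδ {γ | ∃ α < δ, γ = st δ α ∧ r δ γ ≤ ν}
      (by rintro _ ⟨α, hα, rfl, -⟩; exact h.lt hα) (h.card_steps_lt hX δ ν)
    obtain ⟨x, y, hx, hxy, hfx, hyδ, heq⟩ := hF δ
      (fun x hx => (le_max_right _ _).trans_lt (hcl x hx)) (max η₁ η₂) (max_lt hη₁ hη₂)
    have hxδ := hxy.trans hyδ
    have hrank : ν < r δ (st δ x) := by
      by_contra! hle
      exact (hη₂' _ ⟨x, hxδ, rfl, hle⟩).not_ge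
        ((le_max_right _ _).trans (hx.trans (h.le hxδ)))
    have hlevel : ∀ k : K, e (r δ (st δ x)) k < t₀ := fun k => by
      have h1 : t k = t₀ := hK k.2
      rw [← h1]
      exact ht k x y ((hη₁' k).le.trans ((le_max_left _ _).trans hx)) hxy ((hf' k x).trans hfx)
        hyδ heq
    refine (hT.card_Iio_lt t₀).not_ge (hKcard.symm.le.trans (mk_le_of_injective
      (f := fun k : K => (⟨e (r δ (st δ x)) k, hlevel k⟩ : Iio t₀)) fun k k' hkk => ?_))
    exact Subtype.ext (he _ ((hν k k.2).trans hrank) ((hν k' k'.2).trans hrank)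
      (congrArg Subtype.val hkk))
  choose k hk using key
  refine ⟨g, fun p => e (r p.1 p.2) (k (g p.1)), fun c f => ?_⟩
  obtain ⟨δ, hδ, hcl, rfl, hlev⟩ := hk c f
  exact ⟨δ, hδ, hcl, rfl, hlev⟩

end

/-! ### Reading a colour off a list of levels -/

section

variable {T Θ Γ : Type*} [LinearOrder T] [LinearOrder Θ]

/-- In a list of levels labelled by elements of `Γ`, the entry `s` is higher than everything before
it, and `m` is a highest entry before `s`. -/
def IsRecordStep (w : List (T × Γ)) (m s : T × Γ) : Prop :=
  ∃ w₁ w₂, w = w₁ ++ s :: w₂ ∧ m ∈ w₁ ∧ (∀ q ∈ w₁, q.1 ≤ m.1) ∧ m.1 < s.1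

/-- The record step from `m` to `s` has a larger `ψ`-value than every other one. -/
def IsDominantStep (ψ : T → T → Θ) (w : List (T × Γ)) (m s : T × Γ) : Prop :=
  IsRecordStep w m s ∧
    ∀ m' s', IsRecordStep w m' s' → s'.1 = s.1 ∨ ψ m'.1 s'.1 < ψ m.1 s.1

theorem IsRecordStep.eq_of_level_eq {w : List (T × Γ)} {m s m' s' : T × Γ}
    (h : IsRecordStep w m s) (h' : IsRecordStep w m' s') (heq : s.1 = s'.1) : s = s' := by
  obtain ⟨w₁, w₂, rfl, hm, hmax, hlt⟩ := h
  obtain ⟨v₁, v₂, hv, hm', hmax', hlt'⟩ := h'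
  rcases List.append_eq_append_iff.1 hv with ⟨l, rfl, hl⟩ | ⟨l, rfl, hl⟩
  · rcases l with _ | ⟨a, l⟩
    · simp at hl; exact hl.1
    · simp only [List.cons_append, List.cons.injEq] at hl
      have := hmax' s (by simp [hl.1])
      exact absurd (this.trans_lt hlt') (by rw [heq]; exact lt_irrefl _)
  · rcases l with _ | ⟨a, l⟩
    · simp at hl; exact hl.1.symm
    · simp only [List.cons_append, List.cons.injEq] at hl
      have := hmax s' (by simp [hl.1])
      exact absurd (this.trans_lt hlt) (by rw [heq]; exact lt_irrefl _)

theorem IsDominantStep.eq {ψ : T → T → Θ} {w : List (T × Γ)} {m s m' s' : T × Γ}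
    (h : IsDominantStep ψ w m s) (h' : IsDominantStep ψ w m' s') : s = s' := by
  rcases h.2 _ _ h'.1 with heq | hlt
  · exact h.1.eq_of_level_eq h'.1 heq.symm
  · rcases h'.2 _ _ h.1 with heq | hlt'
    · exact h.1.eq_of_level_eq h'.1 heq
    · exact absurd hlt hlt'.not_gt

open Classical in
/-- The label of the entry where the dominant record step arrives, and `d` if there is no dominant
record step. -/
noncomputable def recordColour (ψ : T → T → Θ) (w : List (T × Γ)) (d : Γ) : Γ :=
  if h : ∃ s, ∃ m, IsDominantStep ψ w m s then h.choose.2 else d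

/-- If the `ψ`-value from the top `m` of `w₁` to the larger `s` exceeds all `ψ`-values inside `w₁`
and inside `s :: w₂`, then the colour of `w₁ ++ s :: w₂` is the label of `s`. -/
theorem recordColour_append {ψ : T → T → Θ} {w₁ w₂ : List (T × Γ)} {m s : T × Γ} (d : Γ)
    (hm : m ∈ w₁) (hmax : ∀ q ∈ w₁, q.1 ≤ m.1) (hlt : m.1 < s.1)
    (h₁ : ∀ p ∈ w₁, ∀ q ∈ w₁, ψ p.1 q.1 < ψ m.1 s.1)
    (h₂ : ∀ p ∈ s :: w₂, ∀ q ∈ s :: w₂, ψ p.1 q.1 < ψ m.1 s.1) :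
    recordColour ψ (w₁ ++ s :: w₂) d = s.2 := by
  have hdom : IsDominantStep ψ (w₁ ++ s :: w₂) m s := by
    refine ⟨⟨w₁, w₂, rfl, hm, hmax, hlt⟩, fun m' s' ⟨v₁, v₂, hv, hm', hmax', hlt'⟩ => ?_⟩
    rcases List.append_eq_append_iff.1 hv with ⟨l, rfl, hl⟩ | ⟨l, rfl, hl⟩
    · rcases l with _ | ⟨a, l⟩
      · simp at hl; exact Or.inl (by rw [hl.1])
      · -- The record `s'` comes after `s`, so the highest entry before it is not in `w₁`.
        simp only [List.cons_append, List.cons.injEq] at hl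
        obtain ⟨rfl, rfl⟩ := hl
        have hsm : s.1 ≤ m'.1 := hmax' s (by simp)
        refine Or.inr (h₂ _ ?_ _ (by simp))
        rcases List.mem_append.1 hm' with h | h
        · exact absurd (hsm.trans (hmax _ h)) hlt.not_ge
        · simp only [List.mem_cons, List.mem_append] at h ⊢
          tauto
    · rcases l with _ | ⟨a, l⟩
      · simp at hl; exact Or.inl (by rw [hl.1])
      · simp only [List.cons_append, List.cons.injEq] at hl
        obtain ⟨rfl, rfl⟩ := hl
        exact Or.inr (h₁ _ (by simp [hm']) _ (by simp))
  have hex : ∃ s', ∃ m', IsDominantStep ψ (w₁ ++ s :: w₂) m' s' := ⟨s, m, hdom⟩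
  obtain ⟨m', hm'⟩ := hex.choose_spec
  rw [recordColour, dif_pos hex, hm'.eq hdom]

end

/-! ### The colouring of a triple successor -/

section

variable {Λ X T Θ : Type u} [LinearOrder Λ]

/-- The colouring `c` of increasing pairs takes every value constantly on some `a α₀ × b α₁` with
`α₀ < α₁` and `a α₀` below `b α₁`, for any two sequences `a` and `b` of pairwise disjoint sets of
size less than `θ`. -/
def IsStrongColouring (θ : Cardinal.{u}) (c : Λ → Λ → Λ) : Prop :=
  ∀ a b : Λ → Set Λ, (∀ α, #(a α) < θ) → (∀ α, #(b α) < θ) →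
    (Pairwise fun α β => Disjoint (a α) (a β)) → (Pairwise fun α β => Disjoint (b α) (b β)) →
    ∀ γ, ∃ α₀ α₁, α₀ < α₁ ∧ ∀ ζ ∈ a α₀, ∀ ξ ∈ b α₁, ζ < ξ ∧ c ζ ξ = γ

theorem IsRegularOrder.exists_gt_forall_mem_gt (hΛ : IsRegularOrder Λ) {a : Λ → Set Λ}
    (ha : Pairwise fun α β => Disjoint (a α) (a β)) (β η : Λ) :
    ∃ α, β < α ∧ ∀ x ∈ a α, η < x := by
  by_contra! h
  choose f hf hfη using fun α : Ioi β => h α α.2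
  have hcard : #(Ioi β) < #Λ := by
    refine (mk_le_of_injective (f := fun α => (⟨f α, hfη α⟩ : Iic η)) fun α α' heq => ?_).trans_lt
      (hΛ.card_Iic_lt η)
    by_contra hne
    have heq : f α = f α' := congrArg Subtype.val heq
    exact (ha fun h => hne (Subtype.ext h)).le_bot ⟨hf α, heq ▸ hf α'⟩
  obtain ⟨y, hy⟩ := hΛ.exists_forall_mem_lt _ hcard
  obtain ⟨z, hz, hyz⟩ := hΛ.exists_lt_lt β y
  exact lt_asymm hyz (hy z hz)

/-- Fewer than `#A` finite sets in a regular order have a common strict upper bound. -/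
theorem IsRegularOrder.exists_forall_lt_of_finite {A B : Type u} [LinearOrder A]
    (hA : IsRegularOrder A) {b : Set B} (hb : #b < #A) (s : B → Set A)
    (hs : ∀ ξ, (s ξ).Finite) : ∃ y, ∀ ξ ∈ b, ∀ x ∈ s ξ, x < y := by
  choose f hf using fun ξ => hA.exists_forall_mem_lt_of_finite (hs ξ)
  obtain ⟨y, hy⟩ := hA.exists_forall_lt (fun ξ : b => f ξ) hb
  exact ⟨y, fun ξ hξ x hx => (hf ξ x hx).trans (hy ⟨ξ, hξ⟩)⟩

variable [LinearOrder X] [LinearOrder T] [LinearOrder Θ] [WellFoundedLT Λ]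

/-- For fixed `i`, above every large `δ` of large cofinality there is a member `b α` of the family
such that all walks from `b α` to `δ` contain a step of level at least `i`. -/
theorem exists_forall_level_ge {st : Λ → Λ → Λ} {r : Λ → Λ → X} (h : IsStepFunction st r)
    (hΛ : IsRegularOrder Λ) (hX : IsRegularOrder X) {g : Λ → Λ} {L : Λ × Λ → T}
    (hL : ∀ (c : Λ) (f : Λ → Λ), ∃ δ, CofinalityGE #X δ ∧ ClosedUnder f δ ∧ g δ = c ∧
      ∀ η < δ, ∀ t, ∃ x y, η ≤ x ∧ x < y ∧ f x < y ∧ y < δ ∧ st δ x = st δ y ∧ t ≤ L (δ, st δ x))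
    {b : Λ → Set Λ} (hb : ∀ α, #(b α) < #X) (hdb : Pairwise fun α β => Disjoint (b α) (b β))
    (i : T) : ∃ β, ∀ δ, CofinalityGE #X δ → β < δ →
      ∃ α, δ < α ∧ (∀ ξ ∈ b α, δ < ξ) ∧ ∀ ξ ∈ b α, ∃ p ∈ walk st δ ξ, i ≤ L p := by
  by_contra! hcon
  choose D hD hlt hbad using hcon
  obtain ⟨c⟩ := hΛ.nonempty
  obtain ⟨δ, hδ, -, -, hlev⟩ := hL c D
  obtain ⟨α, hα, hbα⟩ := hΛ.exists_gt_forall_mem_gt hdb δ δ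
  obtain ⟨η, hη, hw⟩ := h.exists_walk_append_forall hX hδ (b α) (fun ξ hξ => (hbα ξ hξ).le) (hb α)
  -- Walks from `b α` to the counterexample `D x` pass through `δ` and make a step of high level.
  obtain ⟨x, y, hηx, hxy, hDy, hyδ, heq, hle⟩ := hlev η hη i
  have hDδ : D x < δ := hDy.trans hyδ
  obtain ⟨ξ, hξ, hlow⟩ := hbad x α (hDδ.trans hα) fun ξ hξ => hDδ.trans (hbα ξ hξ)
  refine (hlow (δ, st δ x) ?_).not_ge hle
  rw [hw ξ hξ _ (hηx.trans (hlt x).le) hDδ, h.walk_of_lt hDδ,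
    h.eq_of_mem_Icc (hlt x).le hDy.le hyδ heq]
  simp

/-- The strong colouring, for families of disjoint sets of size less than `#Θ` on an order of
size `#Θ⁺⁺⁺`. -/
theorem exists_strong_colouring [WellFoundedLT X] [WellFoundedLT Θ]
    (hΛ : IsRegularOrder Λ) (hX : IsRegularOrder X) (hT : IsRegularOrder T)
    (hΘ : IsRegularOrder Θ) (hΛX : #Λ = Order.succ #X)
    (hXT : #X = Order.succ #T) (hTΘ : #T = Order.succ #Θ) :
    ∃ c : Λ → Λ → Λ, IsStrongColouring #Θ c := by
  have hltΛ : #X < #Λ := by rw [hΛX]; exact Order.lt_succ _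
  have hltX : #T < #X := by rw [hXT]; exact Order.lt_succ _
  have hltT : #Θ < #T := by rw [hTΘ]; exact Order.lt_succ _
  obtain ⟨st, r, h⟩ := exists_isStepFunction hΛ hΛX
  obtain ⟨g, L, hL⟩ := h.exists_levels hΛ hX hT hΛX hXT
  obtain ⟨e, he⟩ := hT.exists_injOn hTΘ
  refine ⟨fun ζ ξ => recordColour (fun p q => e q p)
    ((walk st ζ ξ).map fun p => (L p, g p.1)) ζ, ?_⟩
  intro a b ha hb hda hdb γ
  have hbX : ∀ α, #(b α) < #X := fun α => (hb α).trans (hltT.trans hltX)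
  choose β hβ using fun i => exists_forall_level_ge h hΛ hX hL hbX hdb i
  obtain ⟨β', hβ'⟩ := hΛ.exists_forall_lt β (hltX.trans hltΛ)
  have hf : ∀ x, ∃ y α, α < y ∧ β' < y ∧ ∀ ζ ∈ a α, x < ζ ∧ ζ < y := by
    intro x
    obtain ⟨α, -, hα⟩ := hΛ.exists_gt_forall_mem_gt hda x x
    obtain ⟨z, hz⟩ := hΛ.exists_forall_mem_lt (a α)
      ((ha α).trans (hltT.trans (hltX.trans hltΛ)))
    obtain ⟨y, h₁, h₂⟩ := hΛ.exists_lt_lt (max α β') z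
    exact ⟨y, α, (le_max_left _ _).trans_lt h₁, (le_max_right _ _).trans_lt h₁,
      fun ζ hζ => ⟨hα ζ hζ, (hz ζ hζ).trans h₂⟩⟩
  choose f A hAf hβf hf using hf
  obtain ⟨δ, hδ, hcl, hgδ, hlev⟩ := hL γ f
  have hβδ : ∀ i, β i < δ := fun i => by
    obtain ⟨z, hz⟩ := hδ.exists_lt hX.isRegular.pos
    exact (hβ' i).trans ((hβf z).trans (hcl z hz))
  -- For each `i : T`, a set `b (α i)` above `δ` whose walks to `δ` reach level `i`, together with
  -- bounds for what is seen on these walks.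
  choose α hα hbα hreach using fun i => hβ i δ hδ (hβδ i)
  choose η₀ hη₀ hw₀ using fun i => h.exists_walk_append_forall hX hδ (b (α i))
    (fun ξ hξ => (hbα i ξ hξ).le) (hbX _)
  obtain ⟨η, hη, hη₀η⟩ := hδ.exists_forall_lt η₀ hη₀ hltX
  choose top htop using fun i => hT.exists_forall_lt_of_finite ((hb (α i)).trans hltT)
    (fun ξ => L '' {p | p ∈ walk st δ ξ}) (fun ξ => (List.finite_toSet _).image L)
  choose ρ hρ using fun i => hΘ.exists_forall_lt_of_finite (hb (α i))
    (fun ξ => image2 (fun p q => e (L q) (L p)) {p | p ∈ walk st δ ξ} {p | p ∈ walk st δ ξ})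
    (fun ξ => (List.finite_toSet _).image2 _ (List.finite_toSet _))
  obtain ⟨ρ₀, hρ₀⟩ := hT.exists_card_fiber ρ hltT
  -- Among the `i` with a common bound `ρ₀`, choose `#Θ` many with separated sets of levels.
  obtain ⟨i, hiρ, hi⟩ := IsRegularOrder.exists_seq (I := Θ) (fun y => ρ y = ρ₀)
    (fun x y => top x < y) (fun ν p => by
      obtain ⟨z, hz⟩ := hT.exists_forall_lt (fun k => top (p k)) ((hΘ.card_Iio_lt ν).trans hltT)
      obtain ⟨y, hy, hzy⟩ := hT.exists_mem_gt hρ₀ z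
      exact ⟨y, hy, fun k => (hz k).trans hzy⟩)
  obtain ⟨j₀, hj₀⟩ := hT.exists_forall_lt (fun ν => top (i ν)) hltT
  obtain ⟨x, y, hηx, hxy, hfy, hyδ, heq, hj⟩ := hlev η hη j₀
  have hfδ : f x < δ := hfy.trans hyδ
  obtain ⟨ρ₁, hρ₁⟩ := hΘ.exists_forall_lt_of_finite (ha (A x))
    (fun ζ => image2 (fun p q => e (L q) (L p)) {p | p ∈ walk st ζ δ} {p | p ∈ walk st ζ δ})
    (fun ζ => (List.finite_toSet _).image2 _ (List.finite_toSet _))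
  have hbelow : ∀ ν, ∀ ξ ∈ b (α (i ν)), ∀ p ∈ walk st δ ξ, L p < L (δ, st δ x) :=
    fun ν ξ hξ p hp => (htop (i ν) ξ hξ _ (mem_image_of_mem L hp)).trans ((hj₀ ν).trans_le hj)
  -- The levels above `i ν` occurring for different `ν` are different, so by injectivity of
  -- `e (L (δ, st δ x))` not all `ν` can have values below a fixed bound.
  have hν : ∃ ν, ∀ ξ ∈ b (α (i ν)), ∀ p ∈ walk st δ ξ, i ν ≤ L p →
      max ρ₀ ρ₁ ≤ e (L (δ, st δ x)) (L p) := by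
    by_contra! hcon
    choose ξ hξ p hp hip hlt using hcon
    refine (hΘ.card_Iio_lt (max ρ₀ ρ₁)).not_ge (mk_le_of_injective
      (f := fun ν => (⟨_, hlt ν⟩ : Iio (max ρ₀ ρ₁))) fun μ ν hμν => ?_)
    have heq' : L (p μ) = L (p ν) := he _ (hbelow μ _ (hξ μ) _ (hp μ))
      (hbelow ν _ (hξ ν) _ (hp ν)) (congrArg Subtype.val hμν)
    have hsep : ∀ μ ν, μ < ν → L (p μ) < L (p ν) := fun μ ν hμν =>
      (htop (i μ) _ (hξ μ) _ (mem_image_of_mem L (hp μ))).trans ((hi μ ν hμν).trans_le (hip ν))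
    rcases lt_trichotomy μ ν with hlt | hlt | hlt
    · exact absurd heq' (hsep _ _ hlt).ne
    · exact hlt
    · exact absurd heq' (hsep _ _ hlt).ne'
  obtain ⟨ν, hν⟩ := hν
  refine ⟨A x, α (i ν), (hAf x).trans (hfδ.trans (hα _)), fun ζ hζ ξ hξ => ?_⟩
  obtain ⟨hxζ, hζf⟩ := hf x ζ hζ
  have hζδ : ζ < δ := hζf.trans hfδ
  refine ⟨hζδ.trans (hbα _ ξ hξ), ?_⟩
  have hwδ : walk st ζ δ = (δ, st δ x) :: walk st ζ (st δ x) := by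
    rw [h.walk_of_lt hζδ, h.eq_of_mem_Icc hxζ.le (hζf.trans hfy).le hyδ heq]
  obtain ⟨p₀, hp₀, hip₀⟩ := hreach (i ν) ξ hξ
  obtain ⟨m, hm, hmax⟩ := exists_max_image {p | p ∈ walk st δ ξ} L (List.finite_toSet _)
    ⟨p₀, hp₀⟩
  have hbig := hν ξ hξ m hm (hip₀.trans (hmax p₀ hp₀))
  simp only [hw₀ (i ν) ξ hξ ζ ((hη₀η _).le.trans (hηx.trans hxζ.le)) hζδ, hwδ, List.map_append,
    List.map_cons]
  rw [recordColour_append (m := (L m, g m.1)) ζ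
    (List.mem_map_of_mem (f := fun p : Λ × Λ => (L p, g p.1)) hm) ?_
    (hbelow ν ξ hξ m hm) ?_ ?_]
  · exact hgδ
  · rintro _ hq
    obtain ⟨q, hq', rfl⟩ := List.mem_map.1 hq
    exact hmax q hq'
  · intro p hp q hq
    obtain ⟨p, hp', rfl⟩ := List.mem_map.1 hp
    obtain ⟨q, hq', rfl⟩ := List.mem_map.1 hq
    have := hρ (i ν) ξ hξ _ (mem_image2_of_mem hp' hq')
    rw [hiρ ν] at this
    exact this.trans_le ((le_max_left _ _).trans hbig)
  · intro p hp q hq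
    rw [← List.map_cons (f := fun p : Λ × Λ => (L p, g p.1)), ← hwδ] at hp hq
    obtain ⟨p, hp', rfl⟩ := List.mem_map.1 hp
    obtain ⟨q, hq', rfl⟩ := List.mem_map.1 hq
    exact (hρ₁ ζ hζ _ (mem_image2_of_mem hp' hq')).trans_le ((le_max_right _ _).trans hbig)

end

/-! ### Prescribing the colours of finitely many rows -/

section

variable {Λ X : Type u} [LinearOrder Λ]

/-- Finitely many distinct sets are separated by their traces on some finite set. -/
theorem exists_finset_inter_injective {J : Type*} [Finite J] [Nonempty X] (E : J → Set X)
    (hE : Function.Injective E) : ∃ (D : Finset X) (P : J → Finset X),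
      (∀ j, E j ∩ D = P j) ∧ Function.Injective P := by
  classical
  have := Fintype.ofFinite J
  have h : ∀ p : J × J, ∃ x, p.1 ≠ p.2 → ¬(x ∈ E p.1 ↔ x ∈ E p.2) := by
    intro p
    by_contra! h
    obtain ⟨x₀⟩ := ‹Nonempty X›
    exact (h x₀).1 (hE (Set.ext fun x => (h x).2))
  choose w hw using h
  let D : Finset X := Finset.univ.image w
  have hP : ∀ j, ((D.filter (· ∈ E j) : Finset X) : Set X) = E j ∩ D := fun j => by
    ext x; simp [and_comm]
  refine ⟨D, fun j => D.filter (· ∈ E j), fun j => (hP j).symm, fun j j' heq => ?_⟩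
  by_contra hne
  refine hw (j, j') hne ?_
  have hmem : w (j, j') ∈ D := Finset.mem_image_of_mem _ (Finset.mem_univ _)
  have h1 := Finset.ext_iff.1 heq (w (j, j'))
  simpa [hmem] using h1

/-- From a strong colouring one obtains a colouring that realizes, for sequences of `J`-indexed rows
with `J` finite, every prescription of colours to the rows.  The points of `Λ` are distinct subsets
`E ζ` of `X`, and a colour of the given colouring codes a finite set of triples `(D, P, v)`, read as
the instruction to use the value `v` if `E ζ ∩ D = P`. -/
theorem IsStrongColouring.exists_rows [WellFoundedLT Λ] {θ : Cardinal.{u}} {c : Λ → Λ → Λ}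
    (hc : IsStrongColouring θ c) (hθ : ℵ₀ ≤ θ) (hΛ : IsRegularOrder Λ) (hX : ℵ₀ ≤ #X)
    (hΛX : #Λ = Order.succ #X) :
    ∃ d : Λ → Λ → Λ, ∀ (J : Type u) [Finite J] (z : Λ → J → Λ) (b : Λ → Set Λ),
      (∀ α α' j j', z α j = z α' j' → α = α' ∧ j = j') → (∀ α, #(b α) < θ) →
      (Pairwise fun α β => Disjoint (b α) (b β)) → ∀ h : J → Λ,
      ∃ α₀ α₁, α₀ < α₁ ∧ ∀ j, ∀ ξ ∈ b α₁, z α₀ j < ξ ∧ d (z α₀ j) ξ = h j := by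
  classical
  have hXinf : Infinite X := infinite_iff.2 hX
  have hltΛ : #X < #Λ := by rw [hΛX]; exact Order.lt_succ _
  have hΛinf : Infinite Λ := infinite_iff.2 hΛ.isRegular.aleph0_le
  obtain ⟨E⟩ : Nonempty (Λ ↪ Set X) := by
    change #Λ ≤ #(Set X)
    rw [hΛX, mk_set]
    exact Order.succ_le_of_lt (cantor _)
  obtain ⟨code⟩ : Nonempty (Finset (Finset X × Finset X × Λ) ≃ Λ) := by
    refine Cardinal.eq.1 ?_
    rw [mk_finset_of_infinite]
    simp only [mk_prod, Cardinal.lift_id, mk_finset_of_infinite]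
    rw [mul_eq_right hΛ.isRegular.aleph0_le hltΛ.le (mk_ne_zero X),
      mul_eq_right hΛ.isRegular.aleph0_le hltΛ.le (mk_ne_zero X)]
  let d : Λ → Λ → Λ := fun ζ ξ =>
    if h : ∃ v D P, (D, P, v) ∈ code.symm (c ζ ξ) ∧ E ζ ∩ D = (P : Set X) then h.choose else ζ
  refine ⟨d, fun J _ z b hz hb hdb h => ?_⟩
  have := Fintype.ofFinite J
  -- Rows whose traces agree on the same finite set receive the same instructions.
  choose D P hP hinj using fun α => exists_finset_inter_injective (fun j => E (z α j))
    (fun j j' heq => (hz _ _ _ _ (E.injective heq)).2)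
  obtain ⟨⟨D₀, P₀⟩, hY⟩ := hΛ.exists_card_fiber (fun α => (D α, P α)) (by
    refine lt_of_le_of_lt ?_ hltΛ
    rw [mk_prod, Cardinal.lift_id, Cardinal.lift_id, mk_finset_of_infinite, ← power_def,
      mk_finset_of_infinite, mk_fintype J, power_natCast]
    exact (mul_le_mul_right (power_nat_le hX) _).trans (mul_eq_self hX).le)
  obtain ⟨o, hoY, ho⟩ := IsRegularOrder.exists_seq (I := Λ) (fun y => (D y, P y) = (D₀, P₀))
    (fun x y : Λ => x < y) (fun ν p => by
      obtain ⟨y, hy⟩ := hΛ.exists_forall_lt p (hΛ.card_Iio_lt ν)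
      obtain ⟨y', hy', hlt⟩ := hΛ.exists_mem_gt hY y
      exact ⟨y', hy', fun i => (hy i).trans hlt⟩)
  have ho' : StrictMono o := fun x y => ho x y
  obtain ⟨α₀, α₁, hlt, hcol⟩ := hc (fun ν => range (z (o ν))) (fun ν => b (o ν))
    (fun ν => (lt_aleph0_iff_set_finite.2 (finite_range _)).trans_le hθ) (fun ν => hb _)
    (fun μ ν hne => Set.disjoint_left.2 (by
      rintro _ ⟨j, rfl⟩ ⟨j', hj'⟩
      exact hne (ho'.injective (hz _ _ _ _ hj').1.symm)))
    (fun μ ν hne => hdb (ho'.injective.ne hne))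
    (code (Finset.univ.image fun j => (D₀, P₀ j, h j)))
  refine ⟨o α₀, o α₁, ho' hlt, fun j ξ hξ => ?_⟩
  obtain ⟨hlt', hcζ⟩ := hcol _ ⟨j, rfl⟩ ξ hξ
  refine ⟨hlt', ?_⟩
  have heq := hoY α₀
  simp only [Prod.mk.injEq] at heq
  have hEP : ∀ j, E (z (o α₀) j) ∩ D₀ = (P₀ j : Set X) := fun j => by
    rw [← heq.1, ← heq.2]; exact hP _ j
  have hex : ∃ v D P, (D, P, v) ∈ code.symm (c (z (o α₀) j) ξ) ∧
      E (z (o α₀) j) ∩ D = (P : Set X) := by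
    refine ⟨h j, D₀, P₀ j, ?_, hEP j⟩
    rw [hcζ, Equiv.symm_apply_apply]
    exact Finset.mem_image_of_mem _ (Finset.mem_univ j)
  obtain ⟨D₁, P₁, hmem, htr⟩ := hex.choose_spec
  simp only [d, dif_pos hex]
  generalize hex.choose = v at hmem ⊢
  rw [hcζ, Equiv.symm_apply_apply, Finset.mem_image] at hmem
  obtain ⟨j', -, hj'⟩ := hmem
  simp only [Prod.mk.injEq] at hj'
  obtain ⟨rfl, rfl, hv⟩ := hj'
  rw [hEP j, Finset.coe_inj, ← heq.2] at htr
  rw [← hv, hinj _ htr]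

end

/-! ### Ordinals below a cardinal -/

section

variable {μ : Cardinal.{u}}

/-- A colouring of increasing pairs as a function on unordered pairs of ordinals. -/
noncomputable def symColouring (c : μ.ord.ToType → μ.ord.ToType → μ.ord.ToType) :
    Sym2 (Set.Iio μ.ord) → Set.Iio μ.ord :=
  Sym2.lift ⟨fun x y => ToType.mk.symm
    (c (min (ToType.mk x) (ToType.mk y)) (max (ToType.mk x) (ToType.mk y))),
    fun x y => by simp only [min_comm, max_comm]⟩

theorem symColouring_of_lt {c : μ.ord.ToType → μ.ord.ToType → μ.ord.ToType} {x y : Set.Iio μ.ord}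
    (h : ToType.mk x < ToType.mk y) :
    symColouring c s(x, y) = ToType.mk.symm (c (ToType.mk x) (ToType.mk y)) := by
  simp only [symColouring, Sym2.lift_mk, min_eq_left h.le, max_eq_right h.le]

/-- The `α`-th set of a family of ordinals, inside `μ.ord.ToType`. -/
def rowSet {i : Ordinal.{u}} (ζ : Set.Iio μ.ord × Set.Iio i → Set.Iio μ.ord)
    (α : μ.ord.ToType) : Set μ.ord.ToType :=
  range fun j : Set.Iio i => ToType.mk (ζ (ToType.mk.symm α, j))

theorem card_rowSet_lt {i : Ordinal.{u}} {θ : Cardinal.{u}} (hi : i < θ.ord)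
    (ζ : Set.Iio μ.ord × Set.Iio i → Set.Iio μ.ord) (α : μ.ord.ToType) : #(rowSet ζ α) < θ := by
  have h : rowSet ζ α =
      range fun j : i.ToType => ToType.mk (ζ (ToType.mk.symm α, ToType.mk.symm j)) :=
    (ToType.mk.symm.surjective.range_comp
      (fun j : Set.Iio i => ToType.mk (ζ (ToType.mk.symm α, j)))).symm
  rw [h]
  refine mk_range_le.trans_lt ?_
  rw [mk_toType]
  exact lt_ord.1 hi

theorem pairwise_disjoint_rowSet {i : Ordinal.{u}} {ζ : Set.Iio μ.ord × Set.Iio i → Set.Iio μ.ord}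
    (hζ : Function.Injective ζ) : Pairwise fun α β => Disjoint (rowSet ζ α) (rowSet ζ β) := by
  intro α β hne
  refine Set.disjoint_left.2 ?_
  rintro _ ⟨j, rfl⟩ ⟨j', hj'⟩
  have := hζ (ToType.mk.injective hj')
  simp only [Prod.mk.injEq] at this
  exact hne (ToType.mk.symm.injective this.1).symm

theorem IsStrongColouring.pr₁ {θ : Cardinal.{u}}
    {c : μ.ord.ToType → μ.ord.ToType → μ.ord.ToType} (hc : IsStrongColouring θ c)
    {θ' : Fin 2 → Cardinal.{u}} (hθ' : ∀ k, θ' k ≤ θ) : Pr₁ μ μ μ θ' := by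
  refine ⟨symColouring c, fun i ζ ⟨hi, hinj, _⟩ γ => ?_⟩
  obtain ⟨α₀, α₁, hlt, h⟩ := hc (rowSet (ζ 0)) (rowSet (ζ 1))
    (fun α => (card_rowSet_lt (hi 0) _ α).trans_le (hθ' 0))
    (fun α => (card_rowSet_lt (hi 1) _ α).trans_le (hθ' 1))
    (pairwise_disjoint_rowSet (hinj 0)) (pairwise_disjoint_rowSet (hinj 1)) (ToType.mk γ)
  refine ⟨ToType.mk.symm α₀, ToType.mk.symm α₁, ToType.mk.symm.lt_iff_lt.2 hlt, fun j₀ j₁ => ?_⟩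
  obtain ⟨hlt', heq⟩ := h _ ⟨j₀, rfl⟩ _ ⟨j₁, rfl⟩
  rw [symColouring_of_lt hlt', heq, OrderIso.symm_apply_apply]

theorem IsStrongColouring.pr₀₀ {X : Type u} {θ : Cardinal.{u}}
    {c : μ.ord.ToType → μ.ord.ToType → μ.ord.ToType} (hc : IsStrongColouring θ c)
    (hμ : μ.IsRegular) (hX : ℵ₀ ≤ #X) (hμX : μ = Order.succ #X) (hθ : ℵ₀ ≤ θ) :
    Pr₀₀ μ μ μ ![ℵ₀, θ] := by
  obtain ⟨d, hd⟩ := hc.exists_rows hθ (isRegularOrder_ord_toType hμ) hX (by rwa [mk_ord_toType])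
  refine ⟨symColouring d, fun i ζ ⟨hi, hinj, _⟩ h => ?_⟩
  have hfin : Finite (i 0).ToType := by
    rw [← lt_aleph0_iff_finite, mk_toType]
    exact lt_ord.1 (hi 0)
  obtain ⟨α₀, α₁, hlt, hcol⟩ := hd (i 0).ToType
    (fun α j => ToType.mk (ζ 0 (ToType.mk.symm α, ToType.mk.symm j))) (rowSet (ζ 1))
    (fun α α' j j' heq => by
      simpa using hinj 0 (ToType.mk.injective heq))
    (card_rowSet_lt (hi 1) _) (pairwise_disjoint_rowSet (hinj 1))
    (fun j => ToType.mk (h (ToType.mk.symm j)))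
  refine ⟨ToType.mk.symm α₀, ToType.mk.symm α₁, ToType.mk.symm.lt_iff_lt.2 hlt, fun j₀ j₁ => ?_⟩
  obtain ⟨hlt', heq⟩ := hcol (ToType.mk j₀) _ ⟨j₁, rfl⟩
  simp only [OrderIso.symm_apply_apply] at hlt' heq
  rw [symColouring_of_lt hlt', heq, OrderIso.symm_apply_apply]

end

theorem theorem0p1 (κ : Cardinal.{u}) (hκ : κ.IsRegular) :
    Pr₁ (Order.succ^[4] κ) (Order.succ^[4] κ) (Order.succ^[4] κ) ![Order.succ κ, Order.succ κ] ∧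
    Pr₁ (Order.succ^[4] κ) (Order.succ^[4] κ) (Order.succ^[4] κ) ![κ, Order.succ κ] ∧
    Pr₀₀ (Order.succ^[4] κ) (Order.succ^[4] κ) (Order.succ^[4] κ) ![ℵ₀, Order.succ κ] := by
  have h0 := hκ.aleph0_le
  have h1 := isRegular_succ h0
  have h2 := isRegular_succ h1.aleph0_le
  have h3 := isRegular_succ h2.aleph0_le
  have h4 := isRegular_succ h3.aleph0_le
  have h4eq : Order.succ^[4] κ = Order.succ (Order.succ (Order.succ (Order.succ κ))) := rfl
  rw [h4eq]
  obtain ⟨c, hc⟩ := exists_strong_colouring (isRegularOrder_ord_toType h4)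
    (isRegularOrder_ord_toType h3) (isRegularOrder_ord_toType h2) (isRegularOrder_ord_toType h1)
    (by simp only [mk_ord_toType]) (by simp only [mk_ord_toType]) (by simp only [mk_ord_toType])
  rw [mk_ord_toType] at hc
  refine ⟨hc.pr₁ ?_, hc.pr₁ ?_, hc.pr₀₀ (X := (Order.succ (Order.succ (Order.succ κ))).ord.ToType)
    h4 ?_ ?_ h1.aleph0_le⟩
  · simp [Fin.forall_fin_two]
  · simp [Fin.forall_fin_two, Order.le_succ]
  · rw [mk_ord_toType]; exact h3.aleph0_le
  · rw [mk_ord_toType]
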